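/- Let $K$ be a commutative ring with $1$; all rings are associative unital $K$-algebras $R$ (the image of $K$ is central). For a subset $S\subseteq R$, let $R\langle X_S\rangle$ be the $K$-algebra freely generated by $R$ and noncommuting indeterminates $x_s$ $(s\in S)$, and let $R\langle S^{-1}\rangle$ be its factor ring by the ideal generated by all $sx_s-1$ and $x_ss-1$, $s\in S$. The set $S$ is called *localizable* if $R\langle S^{-1}\rangle\neq 0$; let $\mathrm{L}(R)$ be the set of localizable subsets of $R$. A set $S\subseteq R$ is *multiplicative* if $SS\subseteq S$, $1\in S$, $0\notin S$. A multiplicative set $S$ is a *left Ore set* if $Sr\cap Rs\neq\emptyset$ for all $r\in R$, $s\in S$; a left Ore set is a *left denominator set* if $rs=0$ with $r\in R$, $s\in S$ implies $tr=0$ for some $t\in S$; right Ore and right denominator sets are defined symmetrically, and *Ore* (*denominator*) sets are those that are both left and right Ore (denominator) sets. Let $\mathrm{Ore}_l(R),\mathrm{Ore}_r(R),\mathrm{Ore}(R)$ be the sets of left, right and two-sided Ore sets of $R$, and $\mathrm{Den}_l(R),\mathrm{Den}(R)$ the sets of left and two-sided denominator sets. For a family $\mathcal{F}$ of subsets of $R$,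 $\max\mathcal{F}$ is the set of its maximal elements with respect to inclusion. Let $\mathcal{C}_R$ be the set of regular elements (non-zero-divisors) of $R$, $\min(R)$ the set of minimal prime ideals of $R$, and for $\mathfrak{p}\in\min(R)$ let $\mathcal{C}(\mathfrak{p})=\{c\in R\mid c+\mathfrak{p}\in\mathcal{C}_{R/\mathfrak{p}}\}$. 1. If $R$ is a semiprime left Goldie ring, then $$\{\mathcal{S}\in\max\mathrm{L}(R)\mid \mathcal{C}_R\subseteq\mathcal{S}\}=\max\mathrm{Den}_l(R)=\{\mathcal{C}(\mathfrak{p})\mid\mathfrak{p}\in\min(R)\}.$$ 2. If $R$ is a semiprime (left and right) Goldie ring, then $$\{\mathcal{S}\in\max\mathrm{L}(R)\mid \mathcal{C}_R\subseteq\mathcal{S}\}=\max\mathrm{Ore}(R)=\max\mathrm{Den}(R)=\{\mathcal{C}(\mathfrak{p})\mid\mathfrak{p}\in\min(R)\}=\mathcal{N}_l=\mathcal{N}_r=\mathcal{N},$$ where $\mathcal{N}_l$, $\mathcal{N}_r$, $\mathcal{N}$ denote the sets of those maximal elements $S$ of $\mathrm{L}(R)\cap\mathrm{Ore}_l(R)$,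 of $\mathrm{L}(R)\cap\mathrm{Ore}_r(R)$ and of $\mathrm{L}(R)\cap\mathrm{Ore}(R)$, respectively, that satisfy $\mathcal{C}_R\subseteq S$. -/

import Mathlib

namespace SetLoc

universe u v

/-! ### Semiprime rings, Goldie rings, prime ideals, regular elements -/

/-- A ring is semiprime if `a R a = 0` implies `a = 0`. -/
def IsSemiprimeRing (R : Type v) [Ring R] : Prop :=
  ∀ a : R, (∀ r : R, a * r * a = 0) → a = 0

/-- The left annihilator `{r | r x = 0 for all x ∈ X}` of a subset `X`, a left ideal. -/
def leftAnn {R : Type v} [Ring R] (X : Set R) : Ideal R where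
  carrier := {r | ∀ x ∈ X, r * x = 0}
  add_mem' := by
    intro a b ha hb x hx
    rw [add_mul, ha x hx, hb x hx, add_zero]
  zero_mem' := by
    intro x _
    exact zero_mul x
  smul_mem' := by
    intro c a ha x hx
    rw [smul_eq_mul, mul_assoc, ha x hx, mul_zero]

/-- A ring is left Goldie if it contains no infinite direct sum of nonzero left ideals and
satisfies the ascending chain condition on left annihilators. (`Ideal R` is the type of left
ideals of `R`.) -/
structure IsLeftGoldie (R : Type v) [Ring R] : Prop where
  no_infinite_direct_sum : ¬ ∃ I : ℕ → Ideal R, (∀ n, I n ≠ ⊥) ∧ iSupIndep I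
  acc_leftAnn : ∀ X : ℕ → Set R, Monotone (fun n => leftAnn (X n)) →
    ∃ n, ∀ m, n ≤ m → leftAnn (X m) = leftAnn (X n)

/-- A ring is right Goldie if its opposite ring is left Goldie. -/
def IsRightGoldie (R : Type v) [Ring R] : Prop :=
  IsLeftGoldie Rᵐᵒᵖ

/-- A ring is Goldie if it is left and right Goldie. -/
def IsGoldie (R : Type v) [Ring R] : Prop :=
  IsLeftGoldie R ∧ IsRightGoldie R

/-- A proper two-sided ideal `p` is prime if `a R b ⊆ p` implies `a ∈ p` or `b ∈ p`. -/
def IsPrimeIdeal {R : Type v} [Ring R] (p : TwoSidedIdeal R) : Prop :=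
  p ≠ ⊤ ∧ ∀ a b : R, (∀ r : R, a * r * b ∈ p) → a ∈ p ∨ b ∈ p

/-- `min(R)`: the set of minimal prime ideals of `R`. -/
def minPrimes (R : Type v) [Ring R] : Set (TwoSidedIdeal R) :=
  {p | Minimal IsPrimeIdeal p}

/-- `𝒞_R`: the set of regular elements (two-sided non-zero-divisors) of `R`. -/
def regularElements (R : Type v) [Ring R] : Set R :=
  {c | IsRegular c}

/-- `𝒞(p)`: the elements of `R` whose image in `R/p` is regular. -/
def regularModulo {R : Type v} [Ring R] (p : TwoSidedIdeal R) : Set R :=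
  {c | (c : p.ringCon.Quotient) ∈ regularElements p.ringCon.Quotient}

/-! ### Ore sets and denominator sets -/

/-- A multiplicative set: `S S ⊆ S`, `1 ∈ S` and `0 ∉ S`. -/
structure IsMultiplicativeSet {R : Type v} [Ring R] (S : Set R) : Prop where
  mul_mem : ∀ a ∈ S, ∀ b ∈ S, a * b ∈ S
  one_mem : (1 : R) ∈ S
  zero_notMem : (0 : R) ∉ S

/-- A left Ore set: a multiplicative set with `S r ∩ R s ≠ ∅` for all `r ∈ R`, `s ∈ S`. -/
structure IsLeftOreSet {R : Type v} [Ring R] (S : Set R) : Prop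
    extends IsMultiplicativeSet S where
  left_ore : ∀ r : R, ∀ s ∈ S, ∃ s' ∈ S, ∃ r' : R, s' * r = r' * s

/-- A right Ore set: a multiplicative set with `r S ∩ s R ≠ ∅` for all `r ∈ R`, `s ∈ S`. -/
structure IsRightOreSet {R : Type v} [Ring R] (S : Set R) : Prop
    extends IsMultiplicativeSet S where
  right_ore : ∀ r : R, ∀ s ∈ S, ∃ s' ∈ S, ∃ r' : R, r * s' = s * r'

/-- A left denominator set: a left Ore set such that `r s = 0` with `s ∈ S` implies `t r = 0`
for some `t ∈ S`. -/
structure IsLeftDenominatorSet {R : Type v} [Ring R] (S : Set R) : Prop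
    extends IsLeftOreSet S where
  left_cancel : ∀ r : R, ∀ s ∈ S, r * s = 0 → ∃ t ∈ S, t * r = 0

/-- A right denominator set: a right Ore set such that `s r = 0` with `s ∈ S` implies `r t = 0`
for some `t ∈ S`. -/
structure IsRightDenominatorSet {R : Type v} [Ring R] (S : Set R) : Prop
    extends IsRightOreSet S where
  right_cancel : ∀ r : R, ∀ s ∈ S, s * r = 0 → ∃ t ∈ S, r * t = 0

/-- An Ore set is a left and right Ore set. -/
def IsOreSet {R : Type v} [Ring R] (S : Set R) : Prop :=
  IsLeftOreSet S ∧ IsRightOreSet S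

/-- A denominator set is a left and right denominator set. -/
def IsDenominatorSet {R : Type v} [Ring R] (S : Set R) : Prop :=
  IsLeftDenominatorSet S ∧ IsRightDenominatorSet S

/-! ### The localization `R⟨S⁻¹⟩` of a `K`-algebra at an arbitrary subset, localizable sets -/

section Localization

variable (K : Type u) {R : Type v} [CommRing K] [Ring R] [Algebra K R] (S : Set R)

/-- The relations that turn the free `K`-algebra on the disjoint union of `R` and `{x_s | s ∈ S}`
into the `K`-algebra `R⟨X_S⟩` freely generated by the `K`-algebra `R` and the noncommuting
indeterminates `x_s`: they make `R → R⟨X_S⟩` a homomorphism of `K`-algebras. -/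
inductive FreeExtRel : FreeAlgebra K (R ⊕ S) → FreeAlgebra K (R ⊕ S) → Prop
  | add (a b : R) : FreeExtRel (FreeAlgebra.ι K (Sum.inl (a + b)))
      (FreeAlgebra.ι K (Sum.inl a) + FreeAlgebra.ι K (Sum.inl b))
  | mul (a b : R) : FreeExtRel (FreeAlgebra.ι K (Sum.inl (a * b)))
      (FreeAlgebra.ι K (Sum.inl a) * FreeAlgebra.ι K (Sum.inl b))
  | scalar (k : K) : FreeExtRel (FreeAlgebra.ι K (Sum.inl (algebraMap K R k)))
      (algebraMap K (FreeAlgebra K (R ⊕ S)) k)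

/-- `R⟨X_S⟩`: the `K`-algebra freely generated by `R` and the indeterminates `x_s`, `s ∈ S`. -/
abbrev FreeExt : Type (max u v) :=
  RingQuot (FreeExtRel K S)

/-- The canonical map `R → R⟨X_S⟩`. -/
noncomputable def FreeExt.of (r : R) : FreeExt K S :=
  RingQuot.mkAlgHom K (FreeExtRel K S) (FreeAlgebra.ι K (Sum.inl r))

/-- The indeterminate `x_s` of `R⟨X_S⟩`. -/
noncomputable def FreeExt.x (s : S) : FreeExt K S :=
  RingQuot.mkAlgHom K (FreeExtRel K S) (FreeAlgebra.ι K (Sum.inr s))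

/-- The relations `s x_s = 1` and `x_s s = 1`, `s ∈ S`. -/
inductive InvRel : FreeExt K S → FreeExt K S → Prop
  | right_inv (s : S) : InvRel (FreeExt.of K S (s : R) * FreeExt.x K S s) 1
  | left_inv (s : S) : InvRel (FreeExt.x K S s * FreeExt.of K S (s : R)) 1

/-- `R⟨S⁻¹⟩`: the factor ring of `R⟨X_S⟩` by the ideal generated by all
`s x_s - 1` and `x_s s - 1`, `s ∈ S`. -/
abbrev SetLocalization : Type (max u v) :=
  RingQuot (InvRel K S)

/-- `S` is a localizable set of the `K`-algebra `R` if `R⟨S⁻¹⟩ ≠ 0`. -/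
def IsLocalizable : Prop :=
  Nontrivial (SetLocalization K S)

end Localization

end SetLoc

/-! All the families have the same maximal members because the sets 𝒞(p), `p` a minimal prime, form
an antichain, belong to each family, and dominate every relevant member (`setOf_maximal_and_le_eq`).

Membership: `p` is the annihilator of an element `y`, so R/p inherits the Goldie conditions, and
some `d` regular modulo `p` satisfies `d p = 0`. Goldie's theorem gives the Ore condition in R/p,
and multiplication by `d` lifts it to R (`isLeftDenominatorSet_regularModulo`). The same `d` yields
the antichain property.

Domination: the elements of S are cancellable modulo an ideal `k`, namely the kernel of R → R⟨S⁻¹⟩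
or the S-torsion ideal. If `k` contains no regular element, it is not essential, hence it
annihilates some nonzero `z` and lies in a maximal annihilator ideal `p`; then S ⊆ 𝒞(p)
(`exists_subset_regularModulo`). The right-hand versions follow by passing to the opposite ring. -/

namespace SetLoc

universe u v

/-! ### Goldie's theorem: essential left ideals, regular elements and the Ore condition. -/

section Goldie

variable {R : Type v} [Ring R]

lemma mem_leftAnn {X : Set R} {r : R} : r ∈ leftAnn X ↔ ∀ x ∈ X, r * x = 0 := Iff.rfl

lemma mem_leftAnn_singleton {x r : R} : r ∈ leftAnn {x} ↔ r * x = 0 := by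
  simp [mem_leftAnn]

/-- The sum of the left ideals generated by the terms of the sequence is direct. -/
def IsLeftIndep (a : ℕ → R) : Prop :=
  ∀ (r : ℕ → R) (N : ℕ), ∑ i ∈ Finset.range N, r i * a i = 0 → ∀ i < N, r i * a i = 0

lemma IsLeftGoldie.exists_eq_zero (hG : IsLeftGoldie R) {a : ℕ → R} (ha : IsLeftIndep a) :
    ∃ n, a n = 0 := by
  by_contra! h0
  refine hG.no_infinite_direct_sum ⟨fun n => Ideal.span {a n}, fun n => ?_, ?_⟩
  · simpa [Ideal.span_singleton_eq_bot] using h0 n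
  · rw [iSupIndep_iff_finsetSum_eq_zero_imp_eq_zero]
    intro s v hv hsum i hi
    have hv' : ∀ i, ∃ r, i ∈ s → r * a i = v i := by
      intro i
      by_cases his : i ∈ s
      · obtain ⟨r, hr⟩ := Ideal.mem_span_singleton'.1 (hv i his)
        exact ⟨r, fun _ => hr⟩
      · exact ⟨0, fun h => absurd h his⟩
    choose r hr using hv'
    obtain ⟨N, hN⟩ := s.exists_nat_subset_range
    have key := ha (fun i => if i ∈ s then r i else 0) N (by
      refine (Finset.sum_subset hN fun j _ hj => ?_).symm.trans (Eq.trans ?_ hsum)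
      · simp only [if_neg hj, zero_mul]
      · exact Finset.sum_congr rfl fun j hj => by simp only [if_pos hj, hr j hj]) i
        (Finset.mem_range.1 (hN hi))
    simpa [hi, hr i hi] using key

lemma isLeftGoldie_of_exists_eq_zero (h : ∀ a : ℕ → R, IsLeftIndep a → ∃ n, a n = 0)
    (hacc : ∀ X : ℕ → Set R, Monotone (fun n => leftAnn (X n)) →
      ∃ n, ∀ m, n ≤ m → leftAnn (X m) = leftAnn (X n)) : IsLeftGoldie R := by
  refine ⟨?_, hacc⟩
  rintro ⟨I, hI, hind⟩
  choose a ha ha0 using fun n => Submodule.exists_mem_ne_zero_of_ne_bot (hI n)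
  obtain ⟨n, hn⟩ := h a fun r N hsum i hi =>
    (iSupIndep_iff_finsetSum_eq_zero_imp_eq_zero I).1 hind (Finset.range N) (fun i => r i * a i)
      (fun i _ => (I i).mul_mem_left _ (ha i)) hsum i (Finset.mem_range.2 hi)
  exact ha0 n hn

lemma IsLeftGoldie.exists_maximal_leftAnn (hG : IsLeftGoldie R) {α : Type*} (f : α → Set R)
    (P : α → Prop) {a₀ : α} (h₀ : P a₀) :
    ∃ a, P a ∧ leftAnn (f a₀) ≤ leftAnn (f a) ∧
      ∀ b, P b → leftAnn (f a) ≤ leftAnn (f b) → leftAnn (f b) ≤ leftAnn (f a) := by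
  have hwf : WellFoundedGT (Set.range (leftAnn : Set R → Ideal R)) := by
    rw [wellFoundedGT_iff_monotone_chain_condition]
    intro g
    choose X hX using fun n => (g n).2
    obtain ⟨n, hn⟩ := hG.acc_leftAnn X fun i j hij => by
      simp only [hX]
      exact g.monotone hij
    exact ⟨n, fun m hm => Subtype.ext (by rw [← hX, ← hX, hn m hm])⟩
  obtain ⟨_, ⟨a, ⟨ha, ha₀⟩, rfl⟩, hmax⟩ := hwf.wf.has_min
    ((fun a => (⟨leftAnn (f a), f a, rfl⟩ : Set.range (leftAnn : Set R → Ideal R))) ''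
      {a | P a ∧ leftAnn (f a₀) ≤ leftAnn (f a)}) ⟨_, a₀, ⟨h₀, le_rfl⟩, rfl⟩
  refine ⟨a, ha, ha₀, fun b hb hab => ?_⟩
  by_contra hba
  exact hmax _ ⟨b, ⟨hb, ha₀.trans hab⟩, rfl⟩ (lt_of_le_not_ge (α := Ideal R) hab hba)

/-- A left ideal is essential if it meets every nonzero left ideal nontrivially. -/
def IsEssential (E : Ideal R) : Prop :=
  ∀ y : R, y ≠ 0 → ∃ t, t * y ≠ 0 ∧ t * y ∈ E

lemma IsEssential.mono {E F : Ideal R} (hE : IsEssential E) (h : E ≤ F) : IsEssential F :=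
  fun y hy => (hE y hy).imp fun _ ht => ⟨ht.1, h ht.2⟩

lemma IsEssential.residual {E : Ideal R} (hE : IsEssential E) {F : Ideal R} {r : R}
    (hF : ∀ x, x * r ∈ E → x ∈ F) : IsEssential F := by
  intro y hy
  by_cases h : y * r = 0
  · exact ⟨1, by simpa, hF _ (by simp [h])⟩
  · obtain ⟨t, ht, htE⟩ := hE _ h
    rw [← mul_assoc] at ht htE
    exact ⟨t, left_ne_zero_of_mul ht, hF _ htE⟩

/-- The left singular ideal of a semiprime left Goldie ring is zero. -/
lemma eq_zero_of_isEssential_leftAnn (hR : IsSemiprimeRing R) (hG : IsLeftGoldie R) {x : R}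
    (hx : IsEssential (leftAnn {x})) : x = 0 := by
  by_contra hx0
  obtain ⟨z, ⟨hz0, hz⟩, -, hmax⟩ := hG.exists_maximal_leftAnn (fun x : R => {x})
    (fun x => x ≠ 0 ∧ IsEssential (leftAnn {x})) ⟨hx0, hx⟩
  refine hz0 (hR z fun r => ?_)
  by_contra hrz
  have hle : leftAnn {z} ≤ leftAnn {z * r * z} := fun t ht => by
    rw [mem_leftAnn_singleton] at ht ⊢
    rw [mul_assoc, ← mul_assoc, ht, zero_mul]
  have hess : IsEssential (leftAnn {r * z}) := hz.residual (r := r) fun x hx => by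
    rw [mem_leftAnn_singleton] at hx ⊢
    rw [← mul_assoc, hx]
  -- Here `t * z ≠ 0` while `t` kills `z * r * z`, against the maximality of the annihilator of `z`.
  obtain ⟨t, ht0, ht⟩ := hess z hz0
  refine ht0 (mem_leftAnn_singleton.1 (hmax _ ⟨hrz, hz.mono hle⟩ hle ?_))
  rw [mem_leftAnn_singleton] at ht ⊢
  simpa only [mul_assoc] using ht

lemma eq_zero_of_essential_mul_eq_zero (hR : IsSemiprimeRing R) (hG : IsLeftGoldie R)
    {E : Ideal R} (hE : IsEssential E) {x : R} (h : ∀ e ∈ E, e * x = 0) : x = 0 :=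
  eq_zero_of_isEssential_leftAnn hR hG
    (hE.mono fun e he => mem_leftAnn_singleton.2 (h e he))

/-- A nonzero left ideal contains a nonzero element `a` with the same left annihilator as `a²`. -/
lemma exists_mem_leftAnn_sq (hR : IsSemiprimeRing R) (hG : IsLeftGoldie R) {I : Ideal R} {x : R}
    (hxI : x ∈ I) (hx0 : x ≠ 0) :
    ∃ a ∈ I, a ≠ 0 ∧ ∀ r, r * a * a = 0 → r * a = 0 := by
  obtain ⟨z, ⟨hz0, hzI⟩, -, hmax⟩ := hG.exists_maximal_leftAnn (fun x : R => {x})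
    (fun x => x ≠ 0 ∧ x ∈ I) ⟨hx0, hxI⟩
  obtain ⟨r, hr⟩ : ∃ r, z * r * z ≠ 0 := by
    by_contra! h
    exact hz0 (hR z h)
  refine ⟨r * z, I.mul_mem_left _ hzI, fun h => hr (by rw [mul_assoc, h, mul_zero]), ?_⟩
  intro t ht
  have hle : leftAnn {z} ≤ leftAnn {z * r * z} := fun t ht => by
    rw [mem_leftAnn_singleton] at ht ⊢
    rw [mul_assoc, ← mul_assoc, ht, zero_mul]
  have := hmax _ ⟨hr, I.mul_mem_left _ hzI⟩ hle
    (mem_leftAnn_singleton.2 (by simpa only [mul_assoc] using ht) : t * r ∈ _)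
  rw [← mul_assoc]
  exact mem_leftAnn_singleton.1 this

/-- In a relation every term but the zeroth lies in `Rc`, which meets `Ry` trivially; the zeroth
term thus vanishes, and cancelling `c` leaves a shorter relation. -/
lemma isLeftIndep_mul_pow {y c : R} (hc : ∀ r, r * c = 0 → r = 0)
    (hy : ∀ t s, t * y = s * c → t * y = 0) : IsLeftIndep (fun n => y * c ^ n) := by
  intro r N
  induction N generalizing r with
  | zero => simp
  | succ N ih =>
    intro hsum
    simp only at hsum
    have hfac : ∑ i ∈ Finset.range N, r (i + 1) * (y * c ^ (i + 1)) =
        (∑ i ∈ Finset.range N, r (i + 1) * (y * c ^ i)) * c := by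
      rw [Finset.sum_mul]
      exact Finset.sum_congr rfl fun i _ => by rw [pow_succ]; simp only [mul_assoc]
    rw [Finset.sum_range_succ', hfac, pow_zero, mul_one] at hsum
    have h0 : r 0 * y = 0 := hy _ (-∑ i ∈ Finset.range N, r (i + 1) * (y * c ^ i)) (by
      rw [neg_mul]
      exact eq_neg_of_add_eq_zero_right hsum)
    rw [h0, add_zero] at hsum
    have hrest := ih (fun i => r (i + 1)) (hc _ hsum)
    rintro (_ | i) hi
    · simpa using h0
    · have := hrest i (by lia)
      change r (i + 1) * (y * c ^ i) = 0 at this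
      change r (i + 1) * (y * c ^ (i + 1)) = 0
      rw [pow_succ, ← mul_assoc, ← mul_assoc, mul_assoc (r _), this, zero_mul]

/-- If `Rc` missed `Ry`, the elements `y * c ^ n` would be independent, so one would be zero, and
cancelling `c` would give `y = 0`. -/
lemma isEssential_span_singleton (hG : IsLeftGoldie R) {c : R} (hc : ∀ r, r * c = 0 → r = 0) :
    IsEssential (Ideal.span {c}) := by
  intro y hy
  by_contra! h
  have hy' : ∀ t s, t * y = s * c → t * y = 0 := fun t s hts => by
    by_contra h0
    exact h t h0 (Ideal.mem_span_singleton'.2 ⟨s, hts.symm⟩)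
  obtain ⟨n, hn⟩ := hG.exists_eq_zero (isLeftIndep_mul_pow hc hy')
  refine hy ?_
  change y * c ^ n = 0 at hn
  induction n with
  | zero => simpa using hn
  | succ n ih => exact ih (hc _ (by rwa [mul_assoc, ← pow_succ]))

/-- In a semiprime left Goldie ring, an element with zero left annihilator is regular. -/
lemma mem_regularElements_iff (hR : IsSemiprimeRing R) (hG : IsLeftGoldie R) {c : R} :
    c ∈ regularElements R ↔ ∀ r, r * c = 0 → r = 0 := by
  refine ⟨fun h r hr => h.right.eq_iff.1 (by simpa using hr), fun hc => ?_⟩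
  refine ⟨isLeftRegular_iff_right_eq_zero_of_mul.2 fun x hx => ?_,
    isRightRegular_iff_left_eq_zero_of_mul.2 hc⟩
  refine eq_zero_of_essential_mul_eq_zero hR hG (isEssential_span_singleton hG hc) fun e he => ?_
  obtain ⟨s, rfl⟩ := Ideal.mem_span_singleton'.1 he
  rw [mul_assoc, hx, mul_zero]

/-- Multiplying a relation by `a i` on the right kills the later terms by `hlt` and the earlier ones
by induction, leaving `r i * a i * a i = 0`. -/
lemma isLeftIndep_of_mul_eq_zero {a : ℕ → R} (hlt : ∀ m n, n < m → a m * a n = 0)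
    (hsq : ∀ n r, r * a n * a n = 0 → r * a n = 0) : IsLeftIndep a := by
  intro r N hsum i
  induction i using Nat.strong_induction_on with
  | _ i ih =>
    intro hi
    refine hsq i (r i) ?_
    have h := congrArg (· * a i) hsum
    simp only [Finset.sum_mul, zero_mul] at h
    rwa [Finset.sum_eq_single i] at h
    · intro j hj hji
      rcases lt_or_gt_of_ne hji with hji | hji
      · rw [ih j hji (hji.trans hi), zero_mul]
      · rw [mul_assoc, hlt j i hji, mul_zero]
    · intro h'
      exact absurd (Finset.mem_range.2 hi) h'

/-- An essential left ideal of a semiprime left Goldie ring contains a regular element. -/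
theorem IsEssential.exists_regular (hR : IsSemiprimeRing R) (hG : IsLeftGoldie R) {E : Ideal R}
    (hE : IsEssential E) : ∃ c ∈ E, c ∈ regularElements R := by
  by_contra! hno
  -- Without regular elements, each such `c` has a nonzero left annihilator, which meets `E`.
  -- Replacing `c` by `c + a` shrinks the annihilator to that of both summands; iterating from 0
  -- produces infinitely many independent `a`.
  have step : ∀ c : {c : R // c ∈ E ∧ ∀ r, r * c * c = 0 → r * c = 0},
      ∃ a ∈ E, a ≠ 0 ∧ a * c.1 = 0 ∧ ∀ r, r * a * a = 0 → r * a = 0 := by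
    rintro ⟨c, hcE, -⟩
    obtain ⟨y, hyc, hy0⟩ : ∃ y, y * c = 0 ∧ y ≠ 0 := by
      by_contra! h
      exact hno c hcE ((mem_regularElements_iff hR hG).2 h)
    obtain ⟨t, ht0, htE⟩ := hE y hy0
    obtain ⟨a, ha, ha0, hsq⟩ := exists_mem_leftAnn_sq hR hG (I := E ⊓ leftAnn {c})
      ⟨htE, mem_leftAnn_singleton.2 (by rw [mul_assoc, hyc, mul_zero])⟩ ht0
    exact ⟨a, ha.1, ha0, mem_leftAnn_singleton.1 ha.2, hsq⟩
  choose a haE ha0 hac hsq using step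
  have split : ∀ c r, r * (c.1 + a c) = 0 → r * c.1 = 0 ∧ r * a c = 0 := by
    intro c r h
    have hc : r * c.1 = 0 := c.2.2 r (by
      have := congrArg (· * c.1) h
      simpa [mul_add, add_mul, mul_assoc, hac] using this)
    rw [mul_add, hc, zero_add] at h
    exact ⟨hc, h⟩
  let next : {c : R // c ∈ E ∧ ∀ r, r * c * c = 0 → r * c = 0} →
      {c : R // c ∈ E ∧ ∀ r, r * c * c = 0 → r * c = 0} := fun c =>
    ⟨c.1 + a c, E.add_mem c.2.1 (haE c), fun r h => by
      obtain ⟨h1, h2⟩ := split c _ h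
      have hc : r * c.1 = 0 := c.2.2 r (by simpa [mul_add, add_mul, mul_assoc, hac] using h1)
      have ha : r * a c = 0 := hsq c r (by simpa [mul_add, add_mul, hc] using h2)
      rw [mul_add, hc, ha, add_zero]⟩
  let c : ℕ → {c : R // c ∈ E ∧ ∀ r, r * c * c = 0 → r * c = 0} := fun n =>
    next^[n] ⟨0, E.zero_mem, by simp⟩
  have hc : ∀ n, (c (n + 1)).1 = (c n).1 + a (c n) := fun n => by
    simp only [c, Function.iterate_succ_apply', next]
  have hmono : ∀ n m, n ≤ m → ∀ r, r * (c m).1 = 0 → r * (c n).1 = 0 := by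
    intro n m hnm
    induction m, hnm using Nat.le_induction with
    | base => exact fun r h => h
    | succ m _ ih => exact fun r h => ih r (split (c m) r (by rwa [← hc])).1
  obtain ⟨n, hn⟩ := hG.exists_eq_zero (isLeftIndep_of_mul_eq_zero (a := fun n => a (c n))
    (fun m n hnm => (split (c n) _ (by
      rw [← hc]
      exact hmono (n + 1) m hnm _ (hac (c m)))).2) (fun n => hsq (c n)))
  exact ha0 _ hn

/-- The regular elements of a semiprime left Goldie ring satisfy the left Ore condition. -/
theorem exists_regular_mul_eq (hR : IsSemiprimeRing R) (hG : IsLeftGoldie R) (r : R) {c : R}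
    (hc : c ∈ regularElements R) : ∃ c' ∈ regularElements R, ∃ r', c' * r = r' * c := by
  have hess := isEssential_span_singleton hG ((mem_regularElements_iff hR hG).1 hc)
  -- The left ideal of all `x` with `x * r ∈ Rc` is essential, so it contains a regular element.
  obtain ⟨c', hc', hreg⟩ := (hess.residual (r := r)
    (F := Submodule.comap (LinearMap.toSpanSingleton R R r) (Ideal.span {c}))
    (fun x hx => by simpa using hx)).exists_regular hR hG
  obtain ⟨r', hr'⟩ := Ideal.mem_span_singleton'.1 (show c' * r ∈ Ideal.span {c} by simpa using hc')
  exact ⟨c', hreg, r', hr'.symm⟩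

end Goldie

/-! ### Minimal primes as maximal annihilator ideals, and the sets 𝒞(p). -/

section MinimalPrimes

variable {R : Type v} [Ring R]

lemma coe_quotient_eq_zero {p : TwoSidedIdeal R} {x : R} :
    (x : p.ringCon.Quotient) = 0 ↔ x ∈ p := by
  rw [TwoSidedIdeal.mem_iff, ← RingCon.eq]
  rfl

lemma mem_regularModulo_iff {p : TwoSidedIdeal R} {c : R} :
    c ∈ regularModulo p ↔ (∀ x, c * x ∈ p → x ∈ p) ∧ ∀ x, x * c ∈ p → x ∈ p := by
  have hl : IsLeftRegular (c : p.ringCon.Quotient) ↔ ∀ x, c * x ∈ p → x ∈ p := by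
    rw [isLeftRegular_iff_right_eq_zero_of_mul]
    refine ⟨fun h x hx => ?_, fun h x => ?_⟩
    · rw [← coe_quotient_eq_zero] at hx ⊢
      exact h _ (by rwa [← RingCon.coe_mul])
    · induction x using Quotient.inductionOn with | _ x => ?_
      change ((c : p.ringCon.Quotient) * (x : p.ringCon.Quotient) = 0) → (x : p.ringCon.Quotient) = 0
      rw [← RingCon.coe_mul, coe_quotient_eq_zero, coe_quotient_eq_zero]
      exact h x
  have hr : IsRightRegular (c : p.ringCon.Quotient) ↔ ∀ x, x * c ∈ p → x ∈ p := by
    rw [isRightRegular_iff_left_eq_zero_of_mul]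
    refine ⟨fun h x hx => ?_, fun h x => ?_⟩
    · rw [← coe_quotient_eq_zero] at hx ⊢
      exact h _ (by rwa [← RingCon.coe_mul])
    · induction x using Quotient.inductionOn with | _ x => ?_
      change ((x : p.ringCon.Quotient) * (c : p.ringCon.Quotient) = 0) → (x : p.ringCon.Quotient) = 0
      rw [← RingCon.coe_mul, coe_quotient_eq_zero, coe_quotient_eq_zero]
      exact h x
  rw [← hl, ← hr]
  exact ⟨fun h => ⟨h.left, h.right⟩, fun h => ⟨h.1, h.2⟩⟩

lemma IsPrimeIdeal.isSemiprimeRing_quotient {p : TwoSidedIdeal R} (hp : IsPrimeIdeal p) :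
    IsSemiprimeRing p.ringCon.Quotient := by
  intro a
  induction a using Quotient.inductionOn with | _ a => ?_
  intro h
  refine coe_quotient_eq_zero.2 ((hp.2 a a fun r => ?_).elim id id)
  rw [← coe_quotient_eq_zero]
  exact h r

lemma IsPrimeIdeal.one_notMem {p : TwoSidedIdeal R} (hp : IsPrimeIdeal p) : (1 : R) ∉ p :=
  fun h => hp.1 (top_le_iff.1 fun x _ => by simpa using p.mul_mem_left x 1 h)

/-- The left annihilator of the two-sided ideal generated by `y`. -/
def annIdeal (y : R) : TwoSidedIdeal R :=
  .mk' {r | ∀ t, r * t * y = 0} (by simp)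
    (fun {a b} ha hb t => by rw [add_mul, add_mul, ha, hb, add_zero])
    (fun {a} ha t => by rw [neg_mul, neg_mul, ha, neg_zero])
    (fun {a b} hb t => by rw [mul_assoc a, mul_assoc a, hb, mul_zero])
    (fun {a b} ha t => by rw [mul_assoc a, ha])

lemma mem_annIdeal {y r : R} : r ∈ annIdeal y ↔ ∀ t, r * t * y = 0 :=
  TwoSidedIdeal.mem_mk' ..

/-- Makes the chain condition on left annihilators available for the ideals `annIdeal y`. -/
lemma mem_annIdeal_iff_leftAnn {y r : R} :
    r ∈ annIdeal y ↔ r ∈ leftAnn (Set.range (· * y)) := by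
  simp [mem_annIdeal, mem_leftAnn, mul_assoc]

lemma mem_annIdeal_comm (hR : IsSemiprimeRing R) {y r : R} :
    r ∈ annIdeal y ↔ ∀ t, y * t * r = 0 := by
  rw [mem_annIdeal]
  refine ⟨fun h t => hR _ fun s => ?_, fun h t => hR _ fun s => ?_⟩
  · rw [show y * t * r * s * (y * t * r) = y * t * (r * s * y) * (t * r) by noncomm_ring, h]
    simp
  · rw [show r * t * y * s * (r * t * y) = r * t * (y * s * r) * (t * y) by noncomm_ring, h]
    simp

lemma notMem_annIdeal_self (hR : IsSemiprimeRing R) {y : R} (hy : y ≠ 0) : y ∉ annIdeal y :=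
  fun h => hy (hR y (mem_annIdeal.1 h))

/-- The two-sided annihilator of `y` is maximal among those of nonzero elements. -/
def IsMaxAnn (y : R) : Prop :=
  y ≠ 0 ∧ ∀ z, z ≠ 0 → annIdeal y ≤ annIdeal z → annIdeal z ≤ annIdeal y

lemma annIdeal_le_iff {y z : R} : annIdeal y ≤ annIdeal z ↔
    leftAnn (Set.range (· * y)) ≤ leftAnn (Set.range (· * z)) := by
  refine forall_congr' fun r => ?_
  simp only [mem_annIdeal_iff_leftAnn]

lemma IsLeftGoldie.exists_isMaxAnn (hG : IsLeftGoldie R) {z : R} (hz : z ≠ 0) :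
    ∃ y, IsMaxAnn y ∧ annIdeal z ≤ annIdeal y := by
  obtain ⟨y, hy, hzy, hmax⟩ := hG.exists_maximal_leftAnn (fun y : R => Set.range (· * y))
    (fun y => y ≠ 0) hz
  exact ⟨y, ⟨hy, fun w hw h => annIdeal_le_iff.2 (hmax w hw (annIdeal_le_iff.1 h))⟩,
    annIdeal_le_iff.2 hzy⟩

/-- If `b * t * y ≠ 0`, its annihilator ideal contains that of `y`, hence equals it by maximality;
and `aRb ⊆ annIdeal y` puts `a` into it. -/
lemma IsMaxAnn.isPrimeIdeal {y : R} (hy : IsMaxAnn y) : IsPrimeIdeal (annIdeal y) := by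
  refine ⟨fun h => hy.1 ?_, fun a b hab => or_iff_not_imp_right.2 fun hb => ?_⟩
  · have h1 : (1 : R) ∈ annIdeal y := h ▸ trivial
    simpa using mem_annIdeal.1 h1 1
  · rw [mem_annIdeal] at hb
    push Not at hb
    obtain ⟨t, ht⟩ := hb
    refine hy.2 _ ht (fun r hr => mem_annIdeal.2 fun s => ?_) (mem_annIdeal.2 fun s => ?_)
    · simpa only [mul_assoc] using mem_annIdeal.1 hr (s * (b * t))
    · simpa only [mul_assoc] using mem_annIdeal.1 (hab s) t

lemma IsMaxAnn.mem_minPrimes (hR : IsSemiprimeRing R) {y : R} (hy : IsMaxAnn y) :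
    annIdeal y ∈ minPrimes R := by
  refine ⟨hy.isPrimeIdeal, fun q hq hle u hu => ?_⟩
  refine (hq.2 u y fun t => ?_).resolve_right fun h => notMem_annIdeal_self hR hy.1 (hle h)
  rw [mem_annIdeal.1 hu]
  exact q.zero_mem

/-- Every `x ≠ 0` has a nonzero multiple `y * t * x` with `y` maximal; its annihilator ideal
contains that of `y`, so it is itself maximal. -/
lemma isEssential_span_isMaxAnn (hR : IsSemiprimeRing R) (hG : IsLeftGoldie R) :
    IsEssential (Ideal.span {y : R | IsMaxAnn y}) := by
  intro x hx
  obtain ⟨y, hy, hle⟩ := hG.exists_isMaxAnn hx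
  obtain ⟨t, ht⟩ : ∃ t, y * t * x ≠ 0 := by
    by_contra! h
    exact notMem_annIdeal_self hR hy.1 (hle (mem_annIdeal.2 h))
  refine ⟨y * t, ht, Ideal.subset_span ⟨ht, fun z hz h => ?_⟩⟩
  have hle' : annIdeal y ≤ annIdeal (y * t * x) := fun r hr => mem_annIdeal.2 fun s => by
    rw [← mul_assoc, ← mul_assoc, mem_annIdeal.1 hr, zero_mul, zero_mul]
  exact (hy.2 z hz (hle'.trans h)).trans hle'

/-- The minimal primes of a semiprime left Goldie ring are the maximal annihilator ideals. -/
theorem exists_isMaxAnn_of_mem_minPrimes (hR : IsSemiprimeRing R) (hG : IsLeftGoldie R)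
    {p : TwoSidedIdeal R} (hp : p ∈ minPrimes R) : ∃ y, IsMaxAnn y ∧ p = annIdeal y := by
  suffices h : ∃ y, IsMaxAnn y ∧ annIdeal y ≤ p by
    obtain ⟨y, hy, hle⟩ := h
    exact ⟨y, hy, le_antisymm (hp.2 hy.isPrimeIdeal hle) hle⟩
  by_contra! hno
  obtain ⟨c, hc, hreg⟩ := (isEssential_span_isMaxAnn hR hG).exists_regular hR hG
  -- Each generator `y` is annihilated by some element outside `p`; primeness merges finitely many
  -- such annihilators into one.
  have key : ∃ w, w ∉ p ∧ ∀ t, w * t * c = 0 := by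
    clear hreg
    induction hc using Submodule.span_induction with
    | mem y hy =>
      obtain ⟨w, hw, hwp⟩ := SetLike.not_le_iff_exists.1 (hno y hy)
      exact ⟨w, hwp, mem_annIdeal.1 hw⟩
    | zero => exact ⟨1, hp.1.one_notMem, by simp⟩
    | add a b _ _ ha hb =>
      obtain ⟨w, hw, hwa⟩ := ha
      obtain ⟨w', hw', hwb⟩ := hb
      obtain ⟨r, hr⟩ : ∃ r, w * r * w' ∉ p := by
        by_contra! h
        exact (hp.1.2 w w' h).elim hw hw'
      refine ⟨w * r * w', hr, fun t => ?_⟩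
      rw [mul_add, show w * r * w' * t * a = w * (r * w' * t) * a by noncomm_ring, hwa,
        mul_assoc _ w', mul_assoc _ (w' * t), hwb, mul_zero, add_zero]
    | smul r a _ ha =>
      obtain ⟨w, hw, hwa⟩ := ha
      exact ⟨w, hw, fun t => by rw [smul_eq_mul, ← mul_assoc, mul_assoc w, hwa]⟩
  obtain ⟨w, hw, hwc⟩ := key
  have := (mem_regularElements_iff hR hG).1 hreg w (by simpa using hwc 1)
  exact hw (this ▸ p.zero_mem)

/-- The quotient of a semiprime left Goldie ring by an annihilator ideal is left Goldie. -/
theorem isLeftGoldie_quotient_annIdeal (hR : IsSemiprimeRing R) (hG : IsLeftGoldie R) (y : R) :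
    IsLeftGoldie (annIdeal y).ringCon.Quotient := by
  refine isLeftGoldie_of_exists_eq_zero (fun a ha => ?_) fun X hX => ?_
  · choose b hb using fun n => Quotient.exists_rep (a n)
    have hb : ∀ n, (b n : (annIdeal y).ringCon.Quotient) = a n := hb
    by_contra! h0
    have ht : ∀ n, ∃ t, y * t * b n ≠ 0 := fun n => by
      by_contra! h
      exact h0 n ((hb n).symm.trans (coe_quotient_eq_zero.2 ((mem_annIdeal_comm hR).2 h)))
    choose t ht using ht
    -- Independence descends from R/p because an element of `RyR` lying in `annIdeal y` squares to
    -- zero in the sense of semiprimeness.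
    obtain ⟨n, hn⟩ := hG.exists_eq_zero (a := fun n => y * t n * b n) (by
      intro r N hsum i hi
      have hi' := ha (fun i => ((r i * (y * t i) : R) : (annIdeal y).ringCon.Quotient)) N (by
        have := congrArg (RingCon.mk' (annIdeal y).ringCon) hsum
        rw [map_sum, map_zero] at this
        rw [← this]
        refine Finset.sum_congr rfl fun j _ => ?_
        rw [← hb, ← RingCon.coe_mul, mul_assoc]
        rfl) i hi
      simp only [← hb, ← RingCon.coe_mul] at hi'
      rw [coe_quotient_eq_zero] at hi'
      refine hR _ fun s => ?_
      have := mem_annIdeal.1 hi' (s * r i)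
      calc r i * (y * t i * b i) * s * (r i * (y * t i * b i))
          = (r i * (y * t i) * b i * (s * r i) * y) * (t i * b i) := by noncomm_ring
        _ = 0 := by rw [this, zero_mul])
    exact ht n hn
  -- `r` kills `xRy` exactly when `r * x ∈ annIdeal y`, so annihilators in the quotient pull back to
  -- annihilators in R.
  · let Y : ℕ → Set R := fun n =>
      {z | ∃ x t : R, (x : (annIdeal y).ringCon.Quotient) ∈ X n ∧ z = x * t * y}
    have hY : ∀ n (r : R), r ∈ leftAnn (Y n) ↔
        (r : (annIdeal y).ringCon.Quotient) ∈ leftAnn (X n) := by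
      intro n r
      refine ⟨fun h q => ?_, ?_⟩
      · induction q using Quotient.inductionOn with | _ x => ?_
        intro hx
        refine coe_quotient_eq_zero.2 (mem_annIdeal.2 fun t => ?_)
        have := h _ ⟨x, t, hx, rfl⟩
        simpa only [mul_assoc] using this
      · rintro h _ ⟨x, t, hx, rfl⟩
        have := h _ hx
        rw [← RingCon.coe_mul, coe_quotient_eq_zero] at this
        simpa only [mul_assoc] using mem_annIdeal.1 this t
    obtain ⟨n, hn⟩ := hG.acc_leftAnn Y fun i j hij r hr => by
      rw [hY] at hr ⊢
      exact hX hij hr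
    refine ⟨n, fun m hm => ?_⟩
    ext q
    induction q using Quotient.inductionOn with | _ r => ?_
    have hr : r ∈ leftAnn (Y m) ↔ r ∈ leftAnn (Y n) := by rw [hn m hm]
    exact (hY m r).symm.trans (hr.trans (hY n r))

lemma mem_regularModulo_iff_of_minPrimes (hR : IsSemiprimeRing R) (hG : IsLeftGoldie R)
    {p : TwoSidedIdeal R} (hp : p ∈ minPrimes R) {c : R} :
    c ∈ regularModulo p ↔ ∀ x, x * c ∈ p → x ∈ p := by
  refine ⟨fun h => (mem_regularModulo_iff.1 h).2, fun h => ?_⟩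
  obtain ⟨y, hy, rfl⟩ := exists_isMaxAnn_of_mem_minPrimes hR hG hp
  refine (mem_regularElements_iff hp.1.isSemiprimeRing_quotient
    (isLeftGoldie_quotient_annIdeal hR hG y)).2 fun r => ?_
  induction r using Quotient.inductionOn with | _ x => ?_
  intro hx
  exact coe_quotient_eq_zero.2 (h x (coe_quotient_eq_zero.1 hx))

lemma regularElements_subset_regularModulo (hR : IsSemiprimeRing R) (hG : IsLeftGoldie R)
    {p : TwoSidedIdeal R} (hp : p ∈ minPrimes R) : regularElements R ⊆ regularModulo p := by
  intro c hc
  rw [mem_regularModulo_iff_of_minPrimes hR hG hp]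
  obtain ⟨y, hy, rfl⟩ := exists_isMaxAnn_of_mem_minPrimes hR hG hp
  intro x hx
  rw [mem_annIdeal_comm hR] at hx ⊢
  exact fun t => (mem_regularElements_iff hR hG).1 hc _ (by rw [mul_assoc, hx])

/-- The image `B` in R/p of the left annihilator of `p` is essential, since it contains all `y * t *
z`; by Goldie's theorem it contains a regular element. -/
lemma exists_mem_regularModulo_mul_eq_zero (hR : IsSemiprimeRing R) (hG : IsLeftGoldie R)
    {p : TwoSidedIdeal R} (hp : p ∈ minPrimes R) :
    ∃ d ∈ regularModulo p, ∀ x ∈ p, d * x = 0 := by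
  obtain ⟨y, hy, rfl⟩ := exists_isMaxAnn_of_mem_minPrimes hR hG hp
  let B : Ideal (annIdeal y).ringCon.Quotient :=
    { carrier := {q | ∃ u : R, (u : (annIdeal y).ringCon.Quotient) = q ∧
        ∀ x ∈ annIdeal y, u * x = 0}
      add_mem' := by
        rintro _ _ ⟨u, rfl, hu⟩ ⟨w, rfl, hw⟩
        exact ⟨u + w, rfl, fun x hx => by rw [add_mul, hu x hx, hw x hx, add_zero]⟩
      zero_mem' := ⟨0, rfl, by simp⟩
      smul_mem' := by
        rintro q _ ⟨u, rfl, hu⟩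
        induction q using Quotient.inductionOn with | _ r => ?_
        exact ⟨r * u, rfl, fun x hx => by rw [mul_assoc, hu x hx, mul_zero]⟩ }
  have hB : IsEssential B := by
    intro q
    induction q using Quotient.inductionOn with | _ z => ?_
    intro hz
    obtain ⟨t, ht⟩ : ∃ t, y * t * z ∉ annIdeal y := by
      by_contra! h
      rcases hp.1.2 y z h with h | h
      · exact notMem_annIdeal_self hR hy.1 h
      · exact hz (coe_quotient_eq_zero.2 h)
    refine ⟨((y * t : R) : (annIdeal y).ringCon.Quotient),
      fun h => ht (coe_quotient_eq_zero.1 h), y * t * z, rfl, fun x hx => ?_⟩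
    rw [mul_assoc]
    exact (mem_annIdeal_comm hR).1 ((annIdeal y).mul_mem_left z x hx) t
  obtain ⟨_, ⟨d, rfl, hd⟩, hreg⟩ := hB.exists_regular hp.1.isSemiprimeRing_quotient
    (isLeftGoldie_quotient_annIdeal hR hG y)
  exact ⟨d, hreg, hd⟩

/-- The elements regular modulo a minimal prime form a left denominator set. -/
theorem isLeftDenominatorSet_regularModulo (hR : IsSemiprimeRing R) (hG : IsLeftGoldie R)
    {p : TwoSidedIdeal R} (hp : p ∈ minPrimes R) : IsLeftDenominatorSet (regularModulo p) := by
  have hiff := fun c => mem_regularModulo_iff_of_minPrimes (c := c) hR hG hp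
  have hmul : ∀ a ∈ regularModulo p, ∀ b ∈ regularModulo p, a * b ∈ regularModulo p := by
    intro a ha b hb
    rw [hiff] at ha hb ⊢
    exact fun x hx => ha x (hb _ (by rwa [mul_assoc]))
  obtain ⟨d, hd, hdp⟩ := exists_mem_regularModulo_mul_eq_zero hR hG hp
  refine ⟨⟨⟨hmul, by simp [hiff], fun h => ?_⟩, fun r s hs => ?_⟩, fun r s hs hrs => ?_⟩
  · exact hp.1.one_notMem ((hiff 0).1 h 1 (by rw [mul_zero]; exact p.zero_mem))
  · obtain ⟨y, hy, hpy⟩ := exists_isMaxAnn_of_mem_minPrimes hR hG hp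
    obtain ⟨c, hc, b, hcb⟩ := exists_regular_mul_eq hp.1.isSemiprimeRing_quotient
      (hpy ▸ isLeftGoldie_quotient_annIdeal hR hG y) (r : p.ringCon.Quotient) hs
    induction c using Quotient.inductionOn with | _ c => ?_
    induction b using Quotient.inductionOn with | _ b => ?_
    have hmem : c * r - b * s ∈ p := coe_quotient_eq_zero.1 (sub_eq_zero.2 hcb)
    -- The Ore equation holds modulo `p` only; `d` kills the error term.
    refine ⟨d * c, hmul d hd c hc, d * b, ?_⟩
    rw [mul_assoc, mul_assoc, ← sub_eq_zero, ← mul_sub, hdp _ hmem]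
  · exact ⟨d, hd, hdp r ((hiff s).1 hs r (by rw [hrs]; exact p.zero_mem))⟩

lemma eq_of_regularModulo_subset (hR : IsSemiprimeRing R) (hG : IsLeftGoldie R)
    {p q : TwoSidedIdeal R} (hp : p ∈ minPrimes R) (hq : q ∈ minPrimes R)
    (h : regularModulo p ⊆ regularModulo q) : p = q := by
  obtain ⟨d, hd, hdp⟩ := exists_mem_regularModulo_mul_eq_zero hR hG hp
  have hle : p ≤ q := fun x hx => (mem_regularModulo_iff.1 (h hd)).1 x (by
    rw [hdp x hx]
    exact q.zero_mem)
  exact le_antisymm hle (hq.2 hp.1 hle)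

/-- If `S` consists of elements that are right cancellable modulo an ideal `k` containing no
regular element, then the elements of `S` are regular modulo a common minimal prime. -/
theorem exists_subset_regularModulo (hR : IsSemiprimeRing R) (hG : IsLeftGoldie R)
    (k : TwoSidedIdeal R) (hk : ∀ c ∈ k, c ∉ regularElements R) {S : Set R}
    (hS : ∀ s ∈ S, ∀ r, r * s ∈ k → r ∈ k) : ∃ p ∈ minPrimes R, S ⊆ regularModulo p := by
  -- Otherwise `k` would be essential and contain a regular element.
  obtain ⟨z, hz0, hz⟩ : ∃ z, z ≠ 0 ∧ ∀ u ∈ k, u * z = 0 := by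
    by_contra! h
    obtain ⟨c, hc, hreg⟩ := IsEssential.exists_regular hR hG (E := TwoSidedIdeal.asIdeal k)
      fun z hz => (h z hz).imp fun u hu =>
        ⟨hu.2, TwoSidedIdeal.mem_asIdeal.2 (k.mul_mem_right _ _ hu.1)⟩
    exact hk c (TwoSidedIdeal.mem_asIdeal.1 hc) hreg
  obtain ⟨y, hy, hzy⟩ := hG.exists_isMaxAnn hz0
  have hky : k ≤ annIdeal y := fun u hu =>
    hzy (mem_annIdeal.2 fun t => hz _ (k.mul_mem_right u t hu))
  have hp := hy.mem_minPrimes hR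
  refine ⟨annIdeal y, hp, fun s hs => ?_⟩
  rw [mem_regularModulo_iff_of_minPrimes hR hG hp]
  intro x hx
  -- Cancellation is known modulo `k`, not modulo `p`; it applies to `y * t * x`, since `y * t * x *
  -- s = 0`.
  refine (hp.1.2 y x fun t => hky (hS s hs _ ?_)).resolve_left (notMem_annIdeal_self hR hy.1)
  rw [mul_assoc, (mem_annIdeal_comm hR).1 hx t]
  exact k.zero_mem

end MinimalPrimes

/-! ### Left Ore sets, left denominator sets and their torsion ideals. -/

section Denominator

variable {R : Type v} [Ring R]

/-- The annihilators of the powers of `s` stabilize at some `n`. From `s' * r = r' * s ^ n` and `r *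
s = 0`, `r'` kills `s ^ (n + 1)`, hence `s ^ n`. -/
lemma IsLeftOreSet.isLeftDenominatorSet (hG : IsLeftGoldie R) {S : Set R} (hS : IsLeftOreSet S) :
    IsLeftDenominatorSet S := by
  refine ⟨hS, fun r s hs hrs => ?_⟩
  have hpow : ∀ n, s ^ n ∈ S := fun n => by
    induction n with
    | zero => simpa using hS.one_mem
    | succ n ih => rw [pow_succ]; exact hS.mul_mem _ ih _ hs
  obtain ⟨n, hn⟩ := hG.acc_leftAnn (fun n => {s ^ n}) (monotone_nat_of_le_succ fun n t ht => by
    rw [mem_leftAnn_singleton] at ht ⊢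
    rw [pow_succ, ← mul_assoc, ht, zero_mul])
  obtain ⟨s', hs', r', h⟩ := hS.left_ore r (s ^ n) (hpow n)
  refine ⟨s', hs', ?_⟩
  rw [h, ← mem_leftAnn_singleton, ← hn (n + 1) n.le_succ, mem_leftAnn_singleton, pow_succ,
    ← mul_assoc, ← h, mul_assoc, hrs, mul_zero]

/-- The ideal of elements annihilated on the left by an element of a left Ore set. -/
def IsLeftOreSet.torsion {S : Set R} (hS : IsLeftOreSet S) : TwoSidedIdeal R :=
  .mk' {r | ∃ s ∈ S, s * r = 0} ⟨1, hS.one_mem, mul_zero 1⟩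
    (by
      rintro a b ⟨s, hs, ha⟩ ⟨t, ht, hb⟩
      obtain ⟨s', hs', r', h⟩ := hS.left_ore s t ht
      refine ⟨s' * s, hS.mul_mem _ hs' _ hs, ?_⟩
      rw [mul_add, mul_assoc, ha, h, mul_assoc, hb, mul_zero, mul_zero, add_zero])
    (by
      rintro a ⟨s, hs, ha⟩
      exact ⟨s, hs, by rw [mul_neg, ha, neg_zero]⟩)
    (by
      rintro r a ⟨s, hs, ha⟩
      obtain ⟨s', hs', r', h⟩ := hS.left_ore r s hs
      exact ⟨s', hs', by rw [← mul_assoc, h, mul_assoc, ha, mul_zero]⟩)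
    (by
      rintro a r ⟨s, hs, ha⟩
      exact ⟨s, hs, by rw [← mul_assoc, ha, zero_mul]⟩)

lemma IsLeftOreSet.mem_torsion {S : Set R} (hS : IsLeftOreSet S) {r : R} :
    r ∈ hS.torsion ↔ ∃ s ∈ S, s * r = 0 :=
  TwoSidedIdeal.mem_mk' ..

/-- A left denominator set of a semiprime left Goldie ring is regular modulo a minimal prime. -/
theorem IsLeftDenominatorSet.exists_subset_regularModulo (hR : IsSemiprimeRing R)
    (hG : IsLeftGoldie R) {S : Set R} (hS : IsLeftDenominatorSet S) :
    ∃ p ∈ minPrimes R, S ⊆ regularModulo p := by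
  refine SetLoc.exists_subset_regularModulo hR hG hS.toIsLeftOreSet.torsion ?_ ?_
  · intro c hc hreg
    obtain ⟨s, hs, hsc⟩ := hS.mem_torsion.1 hc
    exact hS.zero_notMem ((mem_regularElements_iff hR hG).1 hreg s hsc ▸ hs)
  · intro s hs r hr
    obtain ⟨t, ht, htr⟩ := hS.mem_torsion.1 hr
    obtain ⟨t', ht', h⟩ := hS.left_cancel (t * r) s hs (by rw [mul_assoc, htr])
    exact hS.mem_torsion.2 ⟨t' * t, hS.mul_mem _ ht' _ ht, by rw [mul_assoc, h]⟩

end Denominator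

/-! ### Localizable sets and the map R → R⟨S⁻¹⟩. -/

section Localizable

variable (K : Type u) {R : Type v} [CommRing K] [Ring R] [Algebra K R]

/-- The canonical ring homomorphism `R → R⟨S⁻¹⟩`. -/
noncomputable def toSetLocalization (S : Set R) : R →+* SetLocalization K S where
  toFun r := RingQuot.mkAlgHom K (InvRel K S) (FreeExt.of K S r)
  map_one' := by
    have := RingQuot.mkAlgHom_rel K (FreeExtRel.scalar (S := S) (1 : K))
    rw [map_one, map_one, map_one] at this
    rw [FreeExt.of, this, map_one]
  map_mul' a b := by
    have := RingQuot.mkAlgHom_rel K (FreeExtRel.mul (K := K) (S := S) a b)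
    rw [map_mul] at this
    rw [FreeExt.of, this, map_mul]
    rfl
  map_zero' := by
    have := RingQuot.mkAlgHom_rel K (FreeExtRel.scalar (S := S) (0 : K))
    rw [map_zero, map_zero, map_zero] at this
    rw [FreeExt.of, this, map_zero]
  map_add' a b := by
    have := RingQuot.mkAlgHom_rel K (FreeExtRel.add (K := K) (S := S) a b)
    rw [map_add] at this
    rw [FreeExt.of, this, map_add]
    rfl

lemma isUnit_toSetLocalization {S : Set R} {s : R} (hs : s ∈ S) :
    IsUnit (toSetLocalization K S s) := by
  have h₁ := RingQuot.mkAlgHom_rel K (InvRel.right_inv (K := K) (S := S) ⟨s, hs⟩)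
  have h₂ := RingQuot.mkAlgHom_rel K (InvRel.left_inv (K := K) (S := S) ⟨s, hs⟩)
  rw [map_mul, map_one] at h₁ h₂
  exact ⟨⟨_, _, h₁, h₂⟩, rfl⟩

/-- A set that becomes invertible in a nonzero `K`-algebra is localizable. -/
lemma isLocalizable_of_isUnit {A : Type*} [Ring A] [Algebra K A] [Nontrivial A] (f : R →ₐ[K] A)
    {S : Set R} (hf : ∀ s ∈ S, IsUnit (f s)) : IsLocalizable K S := by
  let g₀ : FreeAlgebra K (R ⊕ S) →ₐ[K] A :=
    FreeAlgebra.lift K (Sum.elim f fun s => ↑(hf s s.2).unit⁻¹)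
  have hg₀ : ∀ r, g₀ (FreeAlgebra.ι K (Sum.inl r)) = f r := fun r => by simp [g₀]
  have hx₀ : ∀ s : S, g₀ (FreeAlgebra.ι K (Sum.inr s)) = ↑(hf s s.2).unit⁻¹ := fun s => by
    simp [g₀]
  let g₁ : FreeExt K S →ₐ[K] A := RingQuot.liftAlgHom K ⟨g₀, by
    rintro _ _ (⟨a, b⟩ | ⟨a, b⟩ | k)
    · simp only [map_add, hg₀]
    · simp only [map_mul, hg₀]
    · simp only [hg₀, AlgHom.commutes]⟩
  have hg₁ : ∀ r, g₁ (FreeExt.of K S r) = f r := fun r => by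
    simp only [g₁, FreeExt.of, RingQuot.liftAlgHom_mkAlgHom_apply, hg₀]
  have hx₁ : ∀ s, g₁ (FreeExt.x K S s) = ↑(hf s s.2).unit⁻¹ := fun s => by
    simp only [g₁, FreeExt.x, RingQuot.liftAlgHom_mkAlgHom_apply, hx₀]
  let g : SetLocalization K S →ₐ[K] A := RingQuot.liftAlgHom K ⟨g₁, by
    rintro _ _ (s | s)
    · simp only [map_mul, hg₁, hx₁, map_one, IsUnit.mul_val_inv]
    · simp only [map_mul, hg₁, hx₁, map_one, IsUnit.val_inv_mul]⟩
  exact g.toRingHom.domain_nontrivial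

/-- A left denominator set is localizable. -/
lemma IsLeftDenominatorSet.isLocalizable {S : Set R} (hS : IsLeftDenominatorSet S) :
    IsLocalizable K S := by
  let M : Submonoid R := ⟨⟨S, fun {a b} ha hb => hS.mul_mem a ha b hb⟩, hS.one_mem⟩
  choose d hd n hn using fun (r : R) (s : M) => hS.left_ore r s s.2
  let _ : OreLocalization.OreSet M :=
    { ore_right_cancel := fun r₁ r₂ s h => by
        obtain ⟨t, ht, h'⟩ := hS.left_cancel (r₁ - r₂) s s.2 (by rw [sub_mul, h, sub_self])
        exact ⟨⟨t, ht⟩, by rwa [mul_sub, sub_eq_zero] at h'⟩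
      oreNum := n
      oreDenom := fun r s => ⟨d r s, hd r s⟩
      ore_eq := hn }
  have : Nontrivial (OreLocalization M R) := by
    rw [OreLocalization.nontrivial_iff]
    exact hS.zero_notMem
  refine isLocalizable_of_isUnit K (A := OreLocalization M R)
    { OreLocalization.numeratorRingHom with commutes' := fun k => ?_ } fun s hs =>
      OreLocalization.numerator_isUnit (⟨s, hs⟩ : M)
  rfl

/-- A localizable set containing the regular elements of a semiprime left Goldie ring is regular
modulo a minimal prime. -/
theorem IsLocalizable.exists_subset_regularModulo (hR : IsSemiprimeRing R) (hG : IsLeftGoldie R)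
    {S : Set R} (hS : IsLocalizable K S) (hreg : regularElements R ⊆ S) :
    ∃ p ∈ minPrimes R, S ⊆ regularModulo p := by
  have : Nontrivial (SetLocalization K S) := hS
  refine SetLoc.exists_subset_regularModulo hR hG
    (TwoSidedIdeal.ker (toSetLocalization K S)) ?_ ?_
  -- Here `𝒞_R ⊆ S` matters: a regular element in the kernel would make 0 a unit.
  · intro c hc hcr
    have := isUnit_toSetLocalization K (hreg hcr)
    rw [(TwoSidedIdeal.mem_ker _).1 hc] at this
    exact not_isUnit_zero this
  · intro s hs r hr
    rw [TwoSidedIdeal.mem_ker] at hr ⊢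
    rw [map_mul] at hr
    exact (isUnit_toSetLocalization K hs).mul_left_eq_zero.1 hr

end Localizable

/-! ### Transfer to the opposite ring. -/

section Opposite

variable {R : Type v} [Ring R]

open MulOpposite

lemma IsSemiprimeRing.op (hR : IsSemiprimeRing R) : IsSemiprimeRing Rᵐᵒᵖ := fun a h =>
  unop_injective (hR a.unop fun r => by simpa [mul_assoc] using congrArg unop (h (MulOpposite.op r)))

lemma isPrimeIdeal_op_iff {p : TwoSidedIdeal R} : IsPrimeIdeal p.op ↔ IsPrimeIdeal p := by
  have htop : p.op = ⊤ ↔ p = ⊤ := map_eq_top_iff TwoSidedIdeal.opOrderIso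
  refine and_congr (not_congr htop) ⟨fun h a b hab => ?_, fun h a b hab => ?_⟩
  · refine (h (MulOpposite.op b) (MulOpposite.op a) fun r => ?_).symm.imp ?_ ?_
    · simpa [mul_assoc] using hab r.unop
    all_goals simp
  · refine (h b.unop a.unop fun r => ?_).symm.imp ?_ ?_
    · simpa [mul_assoc] using hab (MulOpposite.op r)
    all_goals simp

lemma op_mem_minPrimes_iff {p : TwoSidedIdeal R} : p.op ∈ minPrimes Rᵐᵒᵖ ↔ p ∈ minPrimes R := by
  refine and_congr isPrimeIdeal_op_iff ⟨fun h q hq hle => ?_, fun h q hq hle => ?_⟩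
  · exact TwoSidedIdeal.opOrderIso.le_iff_le.1
      (h (isPrimeIdeal_op_iff.2 hq) (TwoSidedIdeal.opOrderIso.le_iff_le.2 hle))
  · obtain ⟨q, rfl⟩ := TwoSidedIdeal.opOrderIso.surjective q
    exact TwoSidedIdeal.opOrderIso.le_iff_le.2
      (h (isPrimeIdeal_op_iff.1 hq) (TwoSidedIdeal.opOrderIso.le_iff_le.1 hle))

lemma op_mem_regularModulo_op_iff {p : TwoSidedIdeal R} {c : R} :
    op c ∈ regularModulo p.op ↔ c ∈ regularModulo p := by
  simp only [mem_regularModulo_iff, TwoSidedIdeal.mem_op_iff, MulOpposite.forall, unop_mul,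
    unop_op]
  exact and_comm

lemma IsRightOreSet.op {S : Set R} (hS : IsRightOreSet S) :
    IsLeftOreSet (MulOpposite.unop ⁻¹' S) where
  mul_mem a ha b hb := hS.mul_mem _ hb _ ha
  one_mem := hS.one_mem
  zero_notMem := hS.zero_notMem
  left_ore r s hs := by
    obtain ⟨s', hs', r', h⟩ := hS.right_ore r.unop s.unop hs
    exact ⟨MulOpposite.op s', hs', MulOpposite.op r', unop_injective h⟩

lemma isRightDenominatorSet_of_op {S : Set R}
    (hS : IsLeftDenominatorSet (MulOpposite.unop ⁻¹' S)) : IsRightDenominatorSet S where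
  mul_mem a ha b hb := hS.mul_mem (MulOpposite.op b) hb (MulOpposite.op a) ha
  one_mem := hS.one_mem
  zero_notMem := hS.zero_notMem
  right_ore r s hs := by
    obtain ⟨s', hs', r', h⟩ := hS.left_ore (MulOpposite.op r) (MulOpposite.op s) hs
    exact ⟨s'.unop, hs', r'.unop, congrArg unop h⟩
  right_cancel r s hs h := by
    obtain ⟨t, ht, h'⟩ := hS.left_cancel (MulOpposite.op r) (MulOpposite.op s) hs
      (congrArg MulOpposite.op h)
    exact ⟨t.unop, ht, congrArg unop h'⟩

lemma regularModulo_op (p : TwoSidedIdeal R) :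
    regularModulo p.op = MulOpposite.unop ⁻¹' regularModulo p :=
  Set.ext fun c => op_mem_regularModulo_op_iff (c := c.unop)

/-- Minimal primes and regularity modulo them are left-right symmetric, so the left-hand theorem for
`Rᵐᵒᵖ` applies. -/
theorem isRightDenominatorSet_regularModulo (hR : IsSemiprimeRing R) (hG : IsRightGoldie R)
    {p : TwoSidedIdeal R} (hp : p ∈ minPrimes R) : IsRightDenominatorSet (regularModulo p) := by
  refine isRightDenominatorSet_of_op ?_
  rw [← regularModulo_op]
  exact isLeftDenominatorSet_regularModulo hR.op hG (op_mem_minPrimes_iff.2 hp)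

theorem IsRightOreSet.exists_subset_regularModulo (hR : IsSemiprimeRing R)
    (hG : IsRightGoldie R) {S : Set R} (hS : IsRightOreSet S) :
    ∃ p ∈ minPrimes R, S ⊆ regularModulo p := by
  obtain ⟨p, hp, hSp⟩ :=
    (hS.op.isLeftDenominatorSet hG).exists_subset_regularModulo hR.op hG
  obtain ⟨p, rfl⟩ := TwoSidedIdeal.opOrderIso.surjective p
  exact ⟨p, op_mem_minPrimes_iff.1 hp, fun s hs =>
    op_mem_regularModulo_op_iff.1 (hSp (show (MulOpposite.op s).unop ∈ S from hs))⟩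

end Opposite

/-! ### Maximal members of a family dominated by an antichain. -/

/-- If every member of a family above `c` lies below a member of an antichain of such members, then
the maximal members of the family above `c` are those of the antichain. -/
lemma setOf_maximal_and_le_eq {α : Type*} [PartialOrder α] {P : α → Prop} {A : Set α} (c : α)
    (hA : IsAntichain (· ≤ ·) A) (hPA : ∀ a ∈ A, P a) (hcA : ∀ a ∈ A, c ≤ a)
    (hle : ∀ x, P x → c ≤ x → ∃ a ∈ A, x ≤ a) : {x | Maximal P x ∧ c ≤ x} = A := by
  ext x
  refine ⟨fun ⟨hx, hcx⟩ => ?_, fun hx => ⟨⟨hPA x hx, fun y hy hxy => ?_⟩, hcA x hx⟩⟩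
  · obtain ⟨a, ha, hxa⟩ := hle x hx.1 hcx
    rwa [le_antisymm hxa (hx.2 (hPA a ha) hxa)]
  · obtain ⟨a, ha, hya⟩ := hle y hy ((hcA x hx).trans hxy)
    rwa [hA.eq hx ha (hxy.trans hya)]

lemma setOf_maximal_eq {α : Type*} [PartialOrder α] [OrderBot α] {P : α → Prop} {A : Set α}
    (hA : IsAntichain (· ≤ ·) A) (hPA : ∀ a ∈ A, P a) (hle : ∀ x, P x → ∃ a ∈ A, x ≤ a) :
    {x | Maximal P x} = A := by
  simpa using setOf_maximal_and_le_eq ⊥ hA hPA (fun _ _ => bot_le) fun x hx _ => hle x hx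

/-! ### Identification of the maximal sets with the 𝒞(p). -/

section Main

variable {R : Type v} [Ring R]

lemma isAntichain_regularModulo (hR : IsSemiprimeRing R) (hG : IsLeftGoldie R) :
    IsAntichain (· ≤ ·) {S : Set R | ∃ p ∈ minPrimes R, S = regularModulo p} := by
  rintro _ ⟨p, hp, rfl⟩ _ ⟨q, hq, rfl⟩ hne hle
  exact hne (congrArg _ (eq_of_regularModulo_subset hR hG hp hq hle))

theorem setOf_maximal_isLocalizable (K : Type u) [CommRing K] [Algebra K R]
    (hR : IsSemiprimeRing R) (hG : IsLeftGoldie R) :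
    {S : Set R | Maximal (IsLocalizable K) S ∧ regularElements R ⊆ S} =
      {S : Set R | ∃ p ∈ minPrimes R, S = regularModulo p} := by
  refine setOf_maximal_and_le_eq _ (isAntichain_regularModulo hR hG) ?_ ?_ fun S hS hreg => ?_
  · rintro _ ⟨p, hp, rfl⟩
    exact (isLeftDenominatorSet_regularModulo hR hG hp).isLocalizable K
  · rintro _ ⟨p, hp, rfl⟩
    exact regularElements_subset_regularModulo hR hG hp
  · obtain ⟨p, hp, h⟩ := hS.exists_subset_regularModulo K hR hG hreg
    exact ⟨_, ⟨p, hp, rfl⟩, h⟩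

theorem setOf_maximal_isLeftDenominatorSet (hR : IsSemiprimeRing R) (hG : IsLeftGoldie R) :
    {S : Set R | Maximal IsLeftDenominatorSet S} =
      {S : Set R | ∃ p ∈ minPrimes R, S = regularModulo p} := by
  refine setOf_maximal_eq (isAntichain_regularModulo hR hG) ?_ fun S hS => ?_
  · rintro _ ⟨p, hp, rfl⟩
    exact isLeftDenominatorSet_regularModulo hR hG hp
  · obtain ⟨p, hp, h⟩ := hS.exists_subset_regularModulo hR hG
    exact ⟨_, ⟨p, hp, rfl⟩, h⟩

lemma isDenominatorSet_regularModulo (hR : IsSemiprimeRing R) (hG : IsGoldie R)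
    {p : TwoSidedIdeal R} (hp : p ∈ minPrimes R) : IsDenominatorSet (regularModulo p) :=
  ⟨isLeftDenominatorSet_regularModulo hR hG.1 hp, isRightDenominatorSet_regularModulo hR hG.2 hp⟩

lemma IsDenominatorSet.isOreSet {S : Set R} (hS : IsDenominatorSet S) : IsOreSet S :=
  ⟨hS.1.toIsLeftOreSet, hS.2.toIsRightOreSet⟩

/-- In a semiprime Goldie ring, the maximal members of a family of one-sided Ore sets that contains
all `𝒞(p)` are the sets `𝒞(p)`. -/
theorem setOf_maximal_eq_regularModulo (hR : IsSemiprimeRing R) (hG : IsGoldie R)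
    {P : Set R → Prop} (hP : ∀ p ∈ minPrimes R, P (regularModulo p))
    (hOre : ∀ S, P S → IsLeftOreSet S ∨ IsRightOreSet S) :
    {S : Set R | Maximal P S} = {S : Set R | ∃ p ∈ minPrimes R, S = regularModulo p} := by
  refine setOf_maximal_eq (isAntichain_regularModulo hR hG.1) ?_ fun S hS => ?_
  · rintro _ ⟨p, hp, rfl⟩
    exact hP p hp
  · obtain ⟨p, hp, h⟩ : ∃ p ∈ minPrimes R, S ⊆ regularModulo p := (hOre S hS).elim
      (fun h => (h.isLeftDenominatorSet hG.1).exists_subset_regularModulo hR hG.1)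
      (fun h => h.exists_subset_regularModulo hR hG.2)
    exact ⟨_, ⟨p, hp, rfl⟩, h⟩

/-- For Ore sets the condition `𝒞_R ⊆ S` excludes nothing: every maximal member is some 𝒞(p), which
contains `𝒞_R`. -/
theorem setOf_maximal_and_regularElements_subset (hR : IsSemiprimeRing R) (hG : IsGoldie R)
    {P : Set R → Prop} (hP : ∀ p ∈ minPrimes R, P (regularModulo p))
    (hOre : ∀ S, P S → IsLeftOreSet S ∨ IsRightOreSet S) :
    {S : Set R | Maximal P S ∧ regularElements R ⊆ S} =
      {S : Set R | ∃ p ∈ minPrimes R, S = regularModulo p} := by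
  rw [Set.ofPred_and, setOf_maximal_eq_regularModulo hR hG hP hOre, Set.inter_eq_left]
  rintro _ ⟨p, hp, rfl⟩
  exact regularElements_subset_regularModulo hR hG.1 hp

end Main

end SetLoc

theorem mainTheorem8 {K : Type*} {R : Type*} [CommRing K] [Ring R] [Algebra K R]
    (hR : SetLoc.IsSemiprimeRing R) :
    -- semiprime left Goldie rings
    (SetLoc.IsLeftGoldie R →
      {S : Set R | Maximal (SetLoc.IsLocalizable K) S ∧ SetLoc.regularElements R ⊆ S} =
          {S : Set R | Maximal SetLoc.IsLeftDenominatorSet S} ∧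
      {S : Set R | Maximal SetLoc.IsLeftDenominatorSet S} =
          {S : Set R | ∃ p ∈ SetLoc.minPrimes R, S = SetLoc.regularModulo p}) ∧
    -- semiprime (left and right) Goldie rings
    (SetLoc.IsGoldie R →
      {S : Set R | Maximal (SetLoc.IsLocalizable K) S ∧ SetLoc.regularElements R ⊆ S} =
          {S : Set R | Maximal SetLoc.IsOreSet S} ∧
      {S : Set R | Maximal SetLoc.IsOreSet S} = {S : Set R | Maximal SetLoc.IsDenominatorSet S} ∧
      {S : Set R | Maximal SetLoc.IsDenominatorSet S} =
          {S : Set R | ∃ p ∈ SetLoc.minPrimes R, S = SetLoc.regularModulo p} ∧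
      {S : Set R | ∃ p ∈ SetLoc.minPrimes R, S = SetLoc.regularModulo p} =
          {S : Set R | Maximal (fun T : Set R => SetLoc.IsLocalizable K T ∧ SetLoc.IsLeftOreSet T) S
            ∧ SetLoc.regularElements R ⊆ S} ∧
      {S : Set R | ∃ p ∈ SetLoc.minPrimes R, S = SetLoc.regularModulo p} =
          {S : Set R | Maximal (fun T : Set R => SetLoc.IsLocalizable K T ∧ SetLoc.IsRightOreSet T) S
            ∧ SetLoc.regularElements R ⊆ S} ∧
      {S : Set R | ∃ p ∈ SetLoc.minPrimes R, S = SetLoc.regularModulo p} =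
          {S : Set R | Maximal (fun T : Set R => SetLoc.IsLocalizable K T ∧ SetLoc.IsOreSet T) S
            ∧ SetLoc.regularElements R ⊆ S}) := by
  refine ⟨fun hG => ?_, fun hG => ?_⟩
  · rw [SetLoc.setOf_maximal_isLocalizable K hR hG,
      SetLoc.setOf_maximal_isLeftDenominatorSet hR hG]
    exact ⟨rfl, rfl⟩
  · have hden := fun p hp => SetLoc.isDenominatorSet_regularModulo (p := p) hR hG hp
    have hloc := fun p hp => (hden p hp).1.isLocalizable K
    rw [SetLoc.setOf_maximal_isLocalizable K hR hG.1,
      SetLoc.setOf_maximal_eq_regularModulo hR hG (P := SetLoc.IsOreSet)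
        (fun p hp => (hden p hp).isOreSet) (fun _ h => .inl h.1),
      SetLoc.setOf_maximal_eq_regularModulo hR hG (P := SetLoc.IsDenominatorSet) hden
        (fun _ h => .inl h.isOreSet.1),
      SetLoc.setOf_maximal_and_regularElements_subset hR hG
        (P := fun T => SetLoc.IsLocalizable K T ∧ SetLoc.IsLeftOreSet T)
        (fun p hp => ⟨hloc p hp, (hden p hp).isOreSet.1⟩) (fun _ h => .inl h.2),
      SetLoc.setOf_maximal_and_regularElements_subset hR hG
        (P := fun T => SetLoc.IsLocalizable K T ∧ SetLoc.IsRightOreSet T)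
        (fun p hp => ⟨hloc p hp, (hden p hp).isOreSet.2⟩) (fun _ h => .inr h.2),
      SetLoc.setOf_maximal_and_regularElements_subset hR hG
        (P := fun T => SetLoc.IsLocalizable K T ∧ SetLoc.IsOreSet T)
        (fun p hp => ⟨hloc p hp, (hden p hp).isOreSet⟩) (fun _ h => .inl h.2.1)]
    exact ⟨rfl, rfl, rfl, rfl, rfl, rfl⟩
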